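/- Let $p,q$ be positive integers and let $(\tilde M^{n+1},\langle\cdot,\cdot\rangle,\tilde\nabla,J)$ be a locally metallic Riemannian manifold: a smooth Riemannian manifold with Levi-Civita connection $\tilde\nabla$ and a smooth $(1,1)$-tensor field $J$ such that $J^2=pJ+qI$, $\langle JX,Y\rangle=\langle X,JY\rangle$ and $\tilde\nabla J=0$. Let $M^n$ be an (immersed) hypersurface of $\tilde M$ with induced metric $g$, Levi-Civita connection $\nabla$ of $g$, a global unit normal vector field $\nu$, and shape operator $A$ defined by the Weingarten formula $\tilde\nabla_X\nu=-AX$. Suppose that $M$ is a quadratic metric $\phi$-hypersurface, i.e. that there are a $(1,1)$-tensor field $\phi$, a $1$-form $\eta$ and a vector field $\xi$ on $M$ with $$JX=\phi X+\eta(X)\nu,\qquad J\nu=q\xi+p\nu,\qquad J\xi=\nu$$ for all $X$ tangent to $M$, and that $(g,\phi,\eta,\xi)$ is an almost quadratic metric $\phi$-structure: $g(\xi,\xi)=1$, $\phi\xi=0$, $\phi^2=p\phi+q(I-\eta\otimes\xi)$ and $g(\phi X,Y)=g(X,\phi Y)$. Then for all vector fields $X,Y$ on $M$ $$(\nabla_X\phi)Y=\eta(Y)AX+g(AX,Y)\xi,$$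 $$\nabla_X\xi=pAX-\phi AX,\qquad A\xi=0,$$ $$(\nabla_X\eta)Y=p\,g(AX,Y)-g(AX,\phi Y).$$ -/

import Mathlib

open Bundle
open scoped Manifold ContDiff

noncomputable section

namespace MetallicHypersurface

section OneManifold

variable {E : Type*} [NormedAddCommGroup E] [NormedSpace ℝ E]
  {H : Type*} [TopologicalSpace H] {I : ModelWithCorners ℝ E H}
  {M : Type*} [TopologicalSpace M] [ChartedSpace H M] [IsManifold I ∞ M]

/-- The covariant derivative `(∇_v φ)Y = ∇_v(φY) - φ(∇_v Y)` at `x` of a `(1,1)`-tensor field. In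
Mathlib's argument order `cov Y x v` is `∇_v Y` at `x`. -/
def covDerivEndo (cov : CovariantDerivative I E (fun x : M ↦ TangentSpace I x))
    (φ : ∀ x : M, TangentSpace I x →L[ℝ] TangentSpace I x)
    (Y : ∀ x : M, TangentSpace I x) (x : M) (v : TangentSpace I x) : TangentSpace I x :=
  cov (fun y ↦ φ y (Y y)) x v - φ x (cov Y x v)

/-- The covariant derivative `(∇_v η)Y = v(η(Y)) - η(∇_v Y)` at `x` of a `1`-form. -/
def covDerivForm (cov : CovariantDerivative I E (fun x : M ↦ TangentSpace I x))
    (η : ∀ x : M, TangentSpace I x →L[ℝ] ℝ)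
    (Y : ∀ x : M, TangentSpace I x) (x : M) (v : TangentSpace I x) : ℝ :=
  mvfderiv I (fun y ↦ η y (Y y)) x v - η x (cov Y x v)

/-- `φ` is a smooth `(1,1)`-tensor field. -/
def IsSmoothEndo
    (φ : ∀ x : M, TangentSpace I x →L[ℝ] TangentSpace I x) : Prop :=
  ContMDiff I (I.prod 𝓘(ℝ, E →L[ℝ] E)) ∞ (fun x ↦ TotalSpace.mk' (E →L[ℝ] E)
    (E := fun x : M ↦ TangentSpace I x →L[ℝ] TangentSpace I x) x (φ x))

/-- `η` is a smooth `1`-form. -/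
def IsSmoothForm (η : ∀ x : M, TangentSpace I x →L[ℝ] ℝ) : Prop :=
  ContMDiff I (I.prod 𝓘(ℝ, E →L[ℝ] ℝ)) ∞ (fun x ↦ TotalSpace.mk' (E →L[ℝ] ℝ)
    (E := fun x : M ↦ TangentSpace I x →L[ℝ] ℝ) x (η x))

/-- `X` is a smooth vector field. -/
def IsSmoothField (X : ∀ x : M, TangentSpace I x) : Prop :=
  ContMDiff I I.tangent ∞ (fun x ↦ (⟨x, X x⟩ : TangentBundle I M))

variable [FiniteDimensional ℝ E]
  [RiemannianBundle (fun x : M ↦ TangentSpace I x)]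
  [IsContMDiffRiemannianBundle I ∞ E (fun x : M ↦ TangentSpace I x)]

/-- `cov` is the Levi-Civita connection of the Riemannian metric: the unique connection on the
tangent bundle that is metric and torsion-free. -/
structure IsLeviCivita (cov : CovariantDerivative I E (fun x : M ↦ TangentSpace I x)) : Prop where
  metric (x : M) (Y Z : ∀ y : M, TangentSpace I y)
    (hY : MDifferentiableAt I I.tangent (fun y ↦ (⟨y, Y y⟩ : TangentBundle I M)) x)
    (hZ : MDifferentiableAt I I.tangent (fun y ↦ (⟨y, Z y⟩ : TangentBundle I M)) x)
    (v : TangentSpace I x) :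
    mvfderiv I (fun y ↦ (inner ℝ (Y y) (Z y) : ℝ)) x v
      = inner ℝ (cov Y x v) (Z x) + inner ℝ (Y x) (cov Z x v)
  torsion_free :
    haveI : CompleteSpace E := FiniteDimensional.complete ℝ E
    cov.torsion = 0

/-- `(g, J)` is a metallic Riemannian structure with parameters `p, q`: positive integers with
`J² = pJ + qI`, and `g(JX, Y) = g(X, JY)`. -/
structure IsMetallicRiemannian (p q : ℕ)
    (J : ∀ x : M, TangentSpace I x →L[ℝ] TangentSpace I x) : Prop where
  p_pos : 0 < p
  q_pos : 0 < q
  smooth : IsSmoothEndo J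
  sq (x : M) (v : TangentSpace I x) : J x (J x v) = (p : ℝ) • J x v + (q : ℝ) • v
  symm (x : M) (v w : TangentSpace I x) : inner ℝ (J x v) w = inner ℝ v (J x w)

/-- A locally metallic Riemannian manifold: a metallic Riemannian manifold with `∇J = 0` for the
Levi-Civita connection `∇`. -/
structure IsLocallyMetallicRiemannian (p q : ℕ)
    (cov : CovariantDerivative I E (fun x : M ↦ TangentSpace I x))
    (J : ∀ x : M, TangentSpace I x →L[ℝ] TangentSpace I x) : Prop where
  metallic : IsMetallicRiemannian p q J
  leviCivita : IsLeviCivita cov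
  parallel (x : M) (Y : ∀ y : M, TangentSpace I y)
    (hY : MDifferentiableAt I I.tangent (fun y ↦ (⟨y, Y y⟩ : TangentBundle I M)) x)
    (v : TangentSpace I x) : covDerivEndo cov J Y x v = 0

/-- `(g, φ, η, ξ)` is an almost quadratic metric `φ`-structure with constants `a, b`: `ξ` is a unit
vector field, `φξ = 0`, `φ² = aφ + b(I - η ⊗ ξ)` with `b ≠ 0` and `a² + 4b ≠ 0`, and
`g(φX, Y) = g(X, φY)`. -/
structure IsAlmostQuadraticMetric (a b : ℝ)
    (φ : ∀ x : M, TangentSpace I x →L[ℝ] TangentSpace I x)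
    (η : ∀ x : M, TangentSpace I x →L[ℝ] ℝ) (ξ : ∀ x : M, TangentSpace I x) : Prop where
  b_ne : b ≠ 0
  disc_ne : a ^ 2 + 4 * b ≠ 0
  smooth_φ : IsSmoothEndo φ
  smooth_η : IsSmoothForm η
  smooth_ξ : IsSmoothField ξ
  unit (x : M) : inner ℝ (ξ x) (ξ x) = (1 : ℝ)
  φ_ξ (x : M) : φ x (ξ x) = 0
  sq (x : M) (v : TangentSpace I x) : φ x (φ x v) = a • φ x v + b • (v - η x v • ξ x)
  symm (x : M) (v w : TangentSpace I x) : inner ℝ (φ x v) w = inner ℝ v (φ x w)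

end OneManifold

section Hypersurface

variable {E : Type*} [NormedAddCommGroup E] [NormedSpace ℝ E]
  {H : Type*} [TopologicalSpace H] {I : ModelWithCorners ℝ E H}
  {M : Type*} [TopologicalSpace M] [ChartedSpace H M] [IsManifold I ∞ M]
  {E' : Type*} [NormedAddCommGroup E'] [NormedSpace ℝ E']
  {H' : Type*} [TopologicalSpace H'] {I' : ModelWithCorners ℝ E' H'}
  {N : Type*} [TopologicalSpace N] [ChartedSpace H' N] [IsManifold I' ∞ N]

/-- The covariant derivative along a map `f : M → N` (the pullback of the connection `cov` on `TN`)
of a vector field `s` along `f`, at `x` and as a linear function of the direction `v ∈ T_xM`.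
If `(e_i)` is the frame of `TN` near `f x` given by the trivialization at `f x`, and
`s = ∑ sⁱ (e_i ∘ f)` near `x`, this is the usual formula
`∇_v s = ∑ dsⁱ(v) e_i + ∑ sⁱ(x) ∇_{df(v)} e_i`; the second sum is the covariant derivative of
`FiberBundle.extend E' (s x) = ∑ sⁱ(x) e_i`. -/
def covAlong (cov : CovariantDerivative I' E' (fun y : N ↦ TangentSpace I' y)) (f : M → N)
    (s : ∀ x : M, TangentSpace I' (f x)) (x : M) :
    TangentSpace I x →L[ℝ] TangentSpace I' (f x) :=
  letI e := trivializationAt E' (TangentSpace I' : N → Type _) (f x)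
  (e.symmL ℝ (f x)).comp
      (mvfderiv I (fun y ↦ (e (⟨f y, s y⟩ : TangentBundle I' N)).2) x) +
    (cov (FiberBundle.extend E' (s x)) (f x)).comp (mfderiv I I' f x)

variable [FiniteDimensional ℝ E] [FiniteDimensional ℝ E']
  [RiemannianBundle (fun x : M ↦ TangentSpace I x)]
  [IsContMDiffRiemannianBundle I ∞ E (fun x : M ↦ TangentSpace I x)]
  [RiemannianBundle (fun y : N ↦ TangentSpace I' y)]
  [IsContMDiffRiemannianBundle I' ∞ E' (fun y : N ↦ TangentSpace I' y)]

/-- `f` is a smooth immersion and the metric of `M` is the one induced by `f` (the second condition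
makes `df` injective). -/
structure IsIsometricImmersion (I : ModelWithCorners ℝ E H) (I' : ModelWithCorners ℝ E' H')
    [IsManifold I ∞ M] [IsManifold I' ∞ N]
    [RiemannianBundle (fun x : M ↦ TangentSpace I x)]
    [RiemannianBundle (fun y : N ↦ TangentSpace I' y)] (f : M → N) : Prop where
  smooth : ContMDiff I I' ∞ f
  isometric (x : M) (v w : TangentSpace I x) :
    inner ℝ (mfderiv I I' f x v) (mfderiv I I' f x w) = inner ℝ v w

/-- `ν` is a (global, smooth) unit normal vector field along `f`. -/
structure IsUnitNormal (I : ModelWithCorners ℝ E H) (f : M → N)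
    (ν : ∀ x : M, TangentSpace I' (f x)) : Prop where
  smooth : ContMDiff I I'.tangent ∞ (fun x ↦ (⟨f x, ν x⟩ : TangentBundle I' N))
  normal (x : M) (v : TangentSpace I x) : inner ℝ (ν x) (mfderiv I I' f x v) = 0
  unit (x : M) : inner ℝ (ν x) (ν x) = (1 : ℝ)

/-- The shape operator `A` with respect to the unit normal field `ν`, as in the Weingarten formula
`∇̃_X ν = -AX`: minus the tangential component of `∇̃_X ν`. The tangential component is taken
with the adjoint of `df`, which, for `df` isometric, is orthogonal projection onto the image of `df`
followed by the inverse of `df`. -/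
def shapeOperator (cov : CovariantDerivative I' E' (fun y : N ↦ TangentSpace I' y)) (f : M → N)
    (ν : ∀ x : M, TangentSpace I' (f x)) (x : M) : TangentSpace I x →L[ℝ] TangentSpace I x :=
  haveI : FiniteDimensional ℝ (TangentSpace I x) := inferInstanceAs (FiniteDimensional ℝ E)
  haveI : FiniteDimensional ℝ (TangentSpace I' (f x)) := inferInstanceAs (FiniteDimensional ℝ E')
  haveI : CompleteSpace (TangentSpace I x) := FiniteDimensional.complete ℝ _
  haveI : CompleteSpace (TangentSpace I' (f x)) := FiniteDimensional.complete ℝ _;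
  -((ContinuousLinearMap.adjoint (mfderiv I I' f x)).comp (covAlong (I := I) cov f ν x))

/-- `f : M → N` (with unit normal `ν` and the induced metric) is a quadratic metric
`φ`-hypersurface of the metallic Riemannian manifold `N` with structure `J` and parameters `p, q`:
the tensors `φ, η, ξ` on `M` satisfy `JX = φX + η(X)ν`, `Jν = qξ + pν`, `Jξ = ν`, and form, with
the induced metric, an almost quadratic metric `φ`-structure with constants `p, q`. -/
structure IsQuadraticMetricHypersurface (p q : ℕ)
    (J : ∀ y : N, TangentSpace I' y →L[ℝ] TangentSpace I' y)
    (f : M → N) (ν : ∀ x : M, TangentSpace I' (f x))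
    (φ : ∀ x : M, TangentSpace I x →L[ℝ] TangentSpace I x)
    (η : ∀ x : M, TangentSpace I x →L[ℝ] ℝ) (ξ : ∀ x : M, TangentSpace I x) : Prop where
  codim_one : Module.finrank ℝ E' = Module.finrank ℝ E + 1
  immersion : IsIsometricImmersion I I' f
  normal : IsUnitNormal I f ν
  J_tangent (x : M) (v : TangentSpace I x) :
    J (f x) (mfderiv I I' f x v) = mfderiv I I' f x (φ x v) + η x v • ν x
  J_normal (x : M) : J (f x) (ν x) = (q : ℝ) • mfderiv I I' f x (ξ x) + (p : ℝ) • ν x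
  J_ξ (x : M) : J (f x) (mfderiv I I' f x (ξ x)) = ν x
  almostQuadratic : IsAlmostQuadraticMetric (p : ℝ) (q : ℝ) φ η ξ

end Hypersurface

end MetallicHypersurface

end

/-! The covariant derivative of N, pulled back along f, inherits three properties: it commutes with
J (`covAlong_endo`), it is metric (`covAlong_inner`), and it is torsion-free on fields df(X)
(`covAlong_mfderiv_sub_covAlong_mfderiv`). The last two give the Gauss and Weingarten formulas and
the symmetry of A, because the tangential part of ∇̃(df Y) is metric and torsion-free, hence
Levi-Civita.

The theorem then comes from splitting two identities into tangential and normal parts.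
Differentiating Jν = qξ + pν gives ∇ξ = pA - φA tangentially and g(AX, ξ) = -g(ξ, AX), so g(AX, ξ) =
0, normally; symmetry of A turns this into Aξ = 0. Differentiating JY = φY + η(Y)ν gives (∇φ)Y
tangentially and (∇η)Y normally.

No q appears in the conclusions because Jξ = ν and φξ = 0 give η(ξ) = 1, while symmetry of J gives η
= q g(ξ, ·); together q = 1. -/

set_option linter.unusedSectionVars false

namespace MetallicHypersurface

open Filter VectorField
open scoped Topology

/-! ### Covariant derivative of vector fields along a map. -/

section Along

variable {E : Type*} [NormedAddCommGroup E] [NormedSpace ℝ E]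
  {H : Type*} [TopologicalSpace H] {I : ModelWithCorners ℝ E H}
  {M : Type*} [TopologicalSpace M] [ChartedSpace H M]
  {E' : Type*} [NormedAddCommGroup E'] [NormedSpace ℝ E']
  {H' : Type*} [TopologicalSpace H'] {I' : ModelWithCorners ℝ E' H'}
  {N : Type*} [TopologicalSpace N] [ChartedSpace H' N] [IsManifold I' ∞ N]

/-- Differentiability at a point of a vector field along a map. -/
abbrev MDiffAlongAt (I : ModelWithCorners ℝ E H) (f : M → N)
    (s : ∀ x : M, TangentSpace I' (f x)) (x : M) : Prop :=
  MDifferentiableAt I I'.tangent (fun y ↦ (⟨f y, s y⟩ : TangentBundle I' N)) x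

variable {f : M → N} {s t : ∀ x : M, TangentSpace I' (f x)} {x : M}

lemma MDiffAlongAt.base (hs : MDiffAlongAt I f s x) : MDifferentiableAt I I' f x :=
  ((mdifferentiableAt_totalSpace _ _).1 hs).1

lemma MDiffAlongAt.coord (hs : MDiffAlongAt I f s x) :
    MDifferentiableAt I 𝓘(ℝ, E')
      (fun y ↦ (trivializationAt E' (TangentSpace I' : N → Type _) (f x)
        (⟨f y, s y⟩ : TangentBundle I' N)).2) x :=
  ((mdifferentiableAt_totalSpace _ _).1 hs).2

lemma mdiffAlongAt_of_coord (hf : MDifferentiableAt I I' f x)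
    (hs : MDifferentiableAt I 𝓘(ℝ, E')
      (fun y ↦ (trivializationAt E' (TangentSpace I' : N → Type _) (f x)
        (⟨f y, s y⟩ : TangentBundle I' N)).2) x) : MDiffAlongAt I f s x :=
  (mdifferentiableAt_totalSpace _ _).2 ⟨hf, hs⟩

lemma eventually_mem_baseSet (hf : ContinuousAt f x) :
    ∀ᶠ y in 𝓝 x, f y ∈ (trivializationAt E' (TangentSpace I' : N → Type _) (f x)).baseSet :=
  hf.eventually ((trivializationAt E' (TangentSpace I' : N → Type _) (f x)).open_baseSet.mem_nhds
    (FiberBundle.mem_baseSet_trivializationAt' (f x)))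

lemma eventually_coord_add (hf : ContinuousAt f x) :
    (fun y ↦ (trivializationAt E' (TangentSpace I' : N → Type _) (f x)
        (⟨f y, s y + t y⟩ : TangentBundle I' N)).2) =ᶠ[𝓝 x]
      (fun y ↦ (trivializationAt E' (TangentSpace I' : N → Type _) (f x)
        (⟨f y, s y⟩ : TangentBundle I' N)).2) +
      (fun y ↦ (trivializationAt E' (TangentSpace I' : N → Type _) (f x)
        (⟨f y, t y⟩ : TangentBundle I' N)).2) := by
  filter_upwards [eventually_mem_baseSet (I' := I') hf] with y hy
  exact ((trivializationAt E' (TangentSpace I' : N → Type _) (f x)).linear ℝ hy).map_add _ _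

lemma eventually_coord_smul (hf : ContinuousAt f x) (g : M → ℝ) :
    (fun y ↦ (trivializationAt E' (TangentSpace I' : N → Type _) (f x)
        (⟨f y, g y • s y⟩ : TangentBundle I' N)).2) =ᶠ[𝓝 x]
      g • (fun y ↦ (trivializationAt E' (TangentSpace I' : N → Type _) (f x)
        (⟨f y, s y⟩ : TangentBundle I' N)).2) := by
  filter_upwards [eventually_mem_baseSet (I' := I') hf] with y hy
  exact ((trivializationAt E' (TangentSpace I' : N → Type _) (f x)).linear ℝ hy).map_smul _ _

lemma MDiffAlongAt.add (hs : MDiffAlongAt I f s x) (ht : MDiffAlongAt I f t x) :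
    MDiffAlongAt I f (fun y ↦ s y + t y) x :=
  mdiffAlongAt_of_coord hs.base <|
    (hs.coord.add ht.coord).congr_of_eventuallyEq (eventually_coord_add hs.base.continuousAt)

lemma MDiffAlongAt.smul {g : M → ℝ} (hg : MDifferentiableAt I 𝓘(ℝ) g x)
    (hs : MDiffAlongAt I f s x) : MDiffAlongAt I f (fun y ↦ g y • s y) x :=
  mdiffAlongAt_of_coord hs.base <|
    (MDifferentiableAt.smul hg hs.coord).congr_of_eventuallyEq
      (eventually_coord_smul hs.base.continuousAt g)

lemma MDiffAlongAt.congr (hs : MDiffAlongAt I f s x) (h : ∀ᶠ y in 𝓝 x, s y = t y) :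
    MDiffAlongAt I f t x :=
  MDifferentiableAt.congr_of_eventuallyEq hs (h.mono fun y hy ↦ by simp only [hy])

lemma MDiffAlongAt.comp {Z : ∀ y : N, TangentSpace I' y}
    (hZ : MDifferentiableAt I' I'.tangent (fun y ↦ (⟨y, Z y⟩ : TangentBundle I' N)) (f x))
    (hf : MDifferentiableAt I I' f x) : MDiffAlongAt I f (fun y ↦ Z (f y)) x :=
  MDifferentiableAt.comp x hZ hf

lemma mvfderiv_congr_of_eventuallyEq {F : Type*} [NormedAddCommGroup F] [NormedSpace ℝ F]
    {g g' : M → F} (h : g =ᶠ[𝓝 x] g') : mvfderiv I g x = mvfderiv I g' x := by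
  ext v
  have := h.mfderiv_eq (I := I) (I' := 𝓘(ℝ, F))
  simp only [mvfderiv, this]
  rfl

lemma symmL_coord {y : N} (a : TangentSpace I' y) :
    (trivializationAt E' (TangentSpace I' : N → Type _) y).symmL ℝ y
      ((trivializationAt E' (TangentSpace I' : N → Type _) y (⟨y, a⟩ : TangentBundle I' N)).2) =
      a := by
  have hy := FiberBundle.mem_baseSet_trivializationAt' (F := E')
    (E := (TangentSpace I' : N → Type _)) y
  rw [Trivialization.symmL_apply _ hy]
  exact (trivializationAt E' (TangentSpace I' : N → Type _) y).symm_apply_apply_mk hy a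

lemma covAlong_congr {cov : CovariantDerivative I' E' (fun y : N ↦ TangentSpace I' y)}
    (h : ∀ᶠ y in 𝓝 x, s y = t y) :
    covAlong (I := I) cov f s x = covAlong cov f t x := by
  unfold covAlong
  have h' : (fun y ↦ (trivializationAt E' (TangentSpace I' : N → Type _) (f x)
        (⟨f y, s y⟩ : TangentBundle I' N)).2) =ᶠ[𝓝 x]
      fun y ↦ (trivializationAt E' (TangentSpace I' : N → Type _) (f x)
        (⟨f y, t y⟩ : TangentBundle I' N)).2 := h.mono fun y hy ↦ by simp only [hy]
  rw [h.self_of_nhds, mvfderiv_congr_of_eventuallyEq h']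

/-- `FiberBundle.extend` has constant components in the trivialization at y, so it is additive on
the base set; this is why the equality is only local. -/
lemma eventually_extend_add {y : N} (a b : TangentSpace I' y) :
    ∀ᶠ z in 𝓝 y, (FiberBundle.extend E' a + FiberBundle.extend E' b) z =
      FiberBundle.extend E' (a + b) z := by
  have hy := FiberBundle.mem_baseSet_trivializationAt' (F := E')
    (E := (TangentSpace I' : N → Type _)) y
  set e := trivializationAt E' (TangentSpace I' : N → Type _) y with he
  filter_upwards [e.open_baseSet.mem_nhds hy] with z hz
  have h1 : (e (⟨y, a + b⟩ : TangentBundle I' N)).2 =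
      (e (⟨y, a⟩ : TangentBundle I' N)).2 + (e (⟨y, b⟩ : TangentBundle I' N)).2 :=
    (e.linear ℝ hy).map_add a b
  have h2 := (e.symmₗ ℝ z).map_add (e (⟨y, a⟩ : TangentBundle I' N)).2
    (e (⟨y, b⟩ : TangentBundle I' N)).2
  simp only [FiberBundle.extend, Pi.add_apply, ← he]
  rw [h1]
  simpa only [e.symmₗ_apply hz] using h2.symm

lemma eventually_extend_smul {y : N} (c : ℝ) (a : TangentSpace I' y) :
    ∀ᶠ z in 𝓝 y, (c • FiberBundle.extend E' a : ∀ z : N, TangentSpace I' z) z =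
      FiberBundle.extend E' (c • a) z := by
  have hy := FiberBundle.mem_baseSet_trivializationAt' (F := E')
    (E := (TangentSpace I' : N → Type _)) y
  set e := trivializationAt E' (TangentSpace I' : N → Type _) y with he
  filter_upwards [e.open_baseSet.mem_nhds hy] with z hz
  have h1 : (e (⟨y, c • a⟩ : TangentBundle I' N)).2 = c • (e (⟨y, a⟩ : TangentBundle I' N)).2 :=
    (e.linear ℝ hy).map_smul c a
  have h2 := (e.symmₗ ℝ z).map_smul c (e (⟨y, a⟩ : TangentBundle I' N)).2
  simp only [FiberBundle.extend, Pi.smul_apply, ← he]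
  rw [h1]
  simpa only [e.symmₗ_apply hz] using h2.symm

variable {cov : CovariantDerivative I' E' (fun y : N ↦ TangentSpace I' y)}

/-- With `cov_extend_smul`, makes the Christoffel term of `covAlong` linear in the value s x. -/
lemma cov_extend_add (cov : CovariantDerivative I' E' (fun y : N ↦ TangentSpace I' y)) {y : N}
    (a b : TangentSpace I' y) :
    cov (FiberBundle.extend E' (a + b)) y =
      cov (FiberBundle.extend E' a) y + cov (FiberBundle.extend E' b) y := by
  have ha := FiberBundle.mdifferentiableAt_extend I' E' a
  have hb := FiberBundle.mdifferentiableAt_extend I' E' b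
  have hab := FiberBundle.mdifferentiableAt_extend I' E' (a + b)
  rw [← cov.isCovariantDerivativeOn.add ha hb (Set.mem_univ y)]
  exact (cov.isCovariantDerivativeOn.congr_of_eventuallyEq (mdifferentiableAt_add_section ha hb)
    hab univ_mem (eventually_extend_add a b)).symm

lemma cov_extend_smul (cov : CovariantDerivative I' E' (fun y : N ↦ TangentSpace I' y)) {y : N}
    (c : ℝ) (a : TangentSpace I' y) :
    cov (FiberBundle.extend E' (c • a)) y = c • cov (FiberBundle.extend E' a) y := by
  have ha := FiberBundle.mdifferentiableAt_extend I' E' a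
  have hca := FiberBundle.mdifferentiableAt_extend I' E' (c • a)
  rw [← cov.isCovariantDerivativeOn.smul_const c ha (Set.mem_univ y)]
  exact (cov.isCovariantDerivativeOn.congr_of_eventuallyEq (ha.smul_const_section (a := c))
    hca univ_mem (eventually_extend_smul c a)).symm

lemma covAlong_add (hs : MDiffAlongAt I f s x) (ht : MDiffAlongAt I f t x) :
    covAlong (I := I) cov f (fun y ↦ s y + t y) x = covAlong cov f s x + covAlong cov f t x := by
  unfold covAlong
  rw [mvfderiv_congr_of_eventuallyEq (eventually_coord_add hs.base.continuousAt),
    mvfderiv_add hs.coord ht.coord, cov_extend_add]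
  ext v
  simp only [_root_.add_apply, ContinuousLinearMap.comp_apply, map_add]
  abel

lemma covAlong_smul {g : M → ℝ} (hg : MDifferentiableAt I 𝓘(ℝ) g x)
    (hs : MDiffAlongAt I f s x) :
    covAlong (I := I) cov f (fun y ↦ g y • s y) x =
      g x • covAlong cov f s x + (mvfderiv I g x).smulRight (s x) := by
  unfold covAlong
  rw [mvfderiv_congr_of_eventuallyEq (eventually_coord_smul hs.base.continuousAt g),
    mvfderiv_smul hg hs.coord, cov_extend_smul]
  ext v
  simp only [_root_.add_apply, ContinuousLinearMap.comp_apply, map_add,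
    _root_.smul_apply, map_smul, ContinuousLinearMap.smulRight_apply, symmL_coord,
    smul_add]
  abel

variable [FiniteDimensional ℝ E']

/-- `cov` and `covAlong` along the identity obey the same Leibniz rule, so their difference is
tensorial and sees only Z y. It may be computed on the extension of Z y, whose components are
locally constant, and there it vanishes. -/
lemma cov_eq_coord (cov : CovariantDerivative I' E' (fun y : N ↦ TangentSpace I' y)) {y : N}
    {Z : ∀ y : N, TangentSpace I' y}
    (hZ : MDifferentiableAt I' I'.tangent (fun y ↦ (⟨y, Z y⟩ : TangentBundle I' N)) y) :
    cov Z y = ((trivializationAt E' (TangentSpace I' : N → Type _) y).symmL ℝ y).comp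
      (mvfderiv I' (fun z ↦ (trivializationAt E' (TangentSpace I' : N → Type _) y
        (⟨z, Z z⟩ : TangentBundle I' N)).2) y) + cov (FiberBundle.extend E' (Z y)) y := by
  have hΦ : TensorialAt I' E' (fun Z : ∀ y : N, TangentSpace I' y ↦
      cov Z y - covAlong cov (fun z : N ↦ z) Z y) y :=
    { smul := fun {g σ} hg hσ ↦ by
        have h := covAlong_smul (cov := cov) (f := fun z : N ↦ z) hg hσ
        simp only [Pi.smul_def'] at h ⊢
        rw [h, ← Pi.smul_def', cov.isCovariantDerivativeOn.leibniz hσ hg (Set.mem_univ y)]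
        module
      add := fun {σ τ} hσ hτ ↦ by
        have h := covAlong_add (cov := cov) (f := fun z : N ↦ z) hσ hτ
        simp only [Pi.add_def] at h ⊢
        rw [h, ← Pi.add_def, cov.isCovariantDerivativeOn.add hσ hτ (Set.mem_univ y)]
        abel }
  have hext := FiberBundle.mdifferentiableAt_extend I' E' (Z y)
  have h := hΦ.pointwise hZ hext (by simp)
  have hid : mfderiv I' I' (fun z : N ↦ z) y = ContinuousLinearMap.id ℝ (TangentSpace I' y) :=
    mfderiv_id
  have hself : FiberBundle.extend E' (Z y) y = Z y := FiberBundle.extend_apply_self E' (Z y)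
  have hmem := FiberBundle.mem_baseSet_trivializationAt' (F := E')
    (E := (TangentSpace I' : N → Type _)) y
  have hconst : (fun z ↦ (trivializationAt E' (TangentSpace I' : N → Type _) y
      (⟨z, FiberBundle.extend E' (Z y) z⟩ : TangentBundle I' N)).2) =ᶠ[𝓝 y]
      fun _ ↦ (trivializationAt E' (TangentSpace I' : N → Type _) y
        (⟨y, Z y⟩ : TangentBundle I' N)).2 := by
    filter_upwards [(trivializationAt E' (TangentSpace I' : N → Type _) y).open_baseSet.mem_nhds
      hmem] with z hz
    unfold FiberBundle.extend
    rw [Trivialization.apply_mk_symm _ hz]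
  have h1 : covAlong cov (fun z : N ↦ z) (FiberBundle.extend E' (Z y)) y =
      cov (FiberBundle.extend E' (Z y)) y := by
    unfold covAlong
    rw [mvfderiv_congr_of_eventuallyEq hconst, mvfderiv_const, hself]
    rw [hid]
    simp
  simp only [h1, sub_self, sub_eq_zero] at h
  refine h.trans ?_
  unfold covAlong
  rw [hid]
  rfl

/-- The chain rule applied to the components of Z. This is the property that characterizes the
pullback connection. -/
lemma covAlong_comp {Z : ∀ y : N, TangentSpace I' y}
    (hZ : MDifferentiableAt I' I'.tangent (fun y ↦ (⟨y, Z y⟩ : TangentBundle I' N)) (f x))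
    (hf : MDifferentiableAt I I' f x) :
    covAlong cov f (fun y ↦ Z (f y)) x = (cov Z (f x)).comp (mfderiv I I' f x) := by
  have hc : MDifferentiableAt I' 𝓘(ℝ, E') (fun z ↦ (trivializationAt E'
      (TangentSpace I' : N → Type _) (f x) (⟨z, Z z⟩ : TangentBundle I' N)).2) (f x) :=
    (mdifferentiableAt_section _ _).1 hZ
  rw [cov_eq_coord cov hZ]
  ext v
  have h := mfderiv_comp_apply x hc hf v
  unfold covAlong
  simp only [_root_.add_apply, ContinuousLinearMap.comp_apply]
  congr 2

/-- Every differentiable field along `f` is near `x` a combination of restrictions of differentiable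
fields of `N`, so a property stable under the operations that build such combinations holds for
it. -/
lemma MDiffAlongAt.induction
    {P : ∀ s : (∀ x : M, TangentSpace I' (f x)), MDiffAlongAt I f s x → Prop}
    (congr : ∀ s t hs (h : ∀ᶠ y in 𝓝 x, s y = t y), P s hs → P t (hs.congr h))
    (add : ∀ s t hs ht, P s hs → P t ht → P (fun y ↦ s y + t y) (hs.add ht))
    (smul : ∀ (g : M → ℝ) s (hg : MDifferentiableAt I 𝓘(ℝ) g x) hs, P s hs →
      P (fun y ↦ g y • s y) (MDiffAlongAt.smul hg hs))
    (comp : ∀ (Z : ∀ y : N, TangentSpace I' y)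
      (hZ : MDifferentiableAt I' I'.tangent (fun y ↦ (⟨y, Z y⟩ : TangentBundle I' N)) (f x))
      (hf : MDifferentiableAt I I' f x), P (fun y ↦ Z (f y)) (MDiffAlongAt.comp hZ hf))
    (hs : MDiffAlongAt I f s x) : P s hs := by
  have hx := FiberBundle.mem_baseSet_trivializationAt' (F := E')
    (E := (TangentSpace I' : N → Type _)) (f x)
  set e := trivializationAt E' (TangentSpace I' : N → Type _) (f x) with he
  let b := Module.finBasis ℝ E'
  let c (i) (y : M) : ℝ := b.coord i (e (⟨f y, s y⟩ : TangentBundle I' N)).2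
  have hc (i) : MDifferentiableAt I 𝓘(ℝ) (c i) x :=
    (LinearMap.toContinuousLinearMap (b.coord i)).differentiableAt.comp_mdifferentiableAt hs.coord
  have hE (i) : MDifferentiableAt I' I'.tangent
      (fun y ↦ (⟨y, e.localFrame b i y⟩ : TangentBundle I' N)) (f x) :=
    (contMDiffAt_localFrame_of_mem 1 _ b i hx).mdifferentiableAt one_ne_zero
  have hsum (t : Finset (Fin (Module.finrank ℝ E'))) :
      ∃ h : MDiffAlongAt I f (fun y ↦ ∑ i ∈ t, c i y • e.localFrame b i (f y)) x,
        P (fun y ↦ ∑ i ∈ t, c i y • e.localFrame b i (f y)) h := by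
    induction t using Finset.induction_on with
    -- The empty sum is the restriction of the zero field of N.
    | empty =>
      have h0 : MDifferentiableAt I' I'.tangent
        (fun y ↦ (⟨y, 0⟩ : TangentBundle I' N)) (f x) := mdifferentiableAt_zeroSection ..
      simpa using ⟨MDiffAlongAt.comp h0 hs.base, comp (fun _ ↦ 0) h0 hs.base⟩
    | insert i t hi ih =>
      have hi' := MDiffAlongAt.smul (hc i) (MDiffAlongAt.comp (hE i) hs.base)
      simp only [Finset.sum_insert hi]
      obtain ⟨ih₁, ih₂⟩ := ih
      exact ⟨hi'.add ih₁, add _ _ hi' ih₁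
        (smul _ _ (hc i) (MDiffAlongAt.comp (hE i) hs.base) (comp _ (hE i) hs.base)) ih₂⟩
  obtain ⟨h₁, h₂⟩ := hsum Finset.univ
  refine congr _ _ h₁ ?_ h₂
  -- Where f y stays in the base set, the local frame is a basis and the sum is the expansion of s y
  -- in it.
  filter_upwards [eventually_mem_baseSet (I' := I') hs.base.continuousAt] with y hy
  have h1 (i) : e.localFrame b i (f y) = (e.linearEquivAt ℝ (f y) hy).symm (b i) := by
    rw [e.localFrame_apply_of_mem_baseSet b hy]
    simp [Trivialization.basisAt]
  simp only [h1, c, ← map_smul, ← map_sum]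
  rw [LinearEquiv.symm_apply_eq]
  exact b.sum_repr _

end Along

/-! ### Tensors, parallel endomorphisms and metrics along a map. -/

section Structures

variable {E : Type*} [NormedAddCommGroup E] [NormedSpace ℝ E]
  {H : Type*} [TopologicalSpace H] {I : ModelWithCorners ℝ E H}
  {M : Type*} [TopologicalSpace M] [ChartedSpace H M]
  {E' : Type*} [NormedAddCommGroup E'] [NormedSpace ℝ E']
  {H' : Type*} [TopologicalSpace H'] {I' : ModelWithCorners ℝ E' H'}
  {N : Type*} [TopologicalSpace N] [ChartedSpace H' N] [IsManifold I' ∞ N]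
  {f : M → N} {s t : ∀ x : M, TangentSpace I' (f x)} {x : M}
  {cov : CovariantDerivative I' E' (fun y : N ↦ TangentSpace I' y)}

lemma IsSmoothEndo.mdiffAlongAt {J : ∀ y : N, TangentSpace I' y →L[ℝ] TangentSpace I' y}
    (hJ : IsSmoothEndo J) (hs : MDiffAlongAt I f s x) :
    MDiffAlongAt I f (fun y ↦ J (f y) (s y)) x :=
  MDifferentiableAt.clm_bundle_apply (b := f) (F₁ := E') (F₂ := E')
    (((hJ (f x)).mdifferentiableAt (by simp)).comp x hs.base) hs

lemma IsSmoothForm.mdifferentiableAt {η : ∀ y : N, TangentSpace I' y →L[ℝ] ℝ}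
    (hη : IsSmoothForm η) (hs : MDiffAlongAt I f s x) :
    MDifferentiableAt I 𝓘(ℝ) (fun y ↦ η (f y) (s y)) x := by
  have hη' : MDifferentiableAt I (I'.prod 𝓘(ℝ, E' →L[ℝ] ℝ)) (fun y ↦ TotalSpace.mk' (E' →L[ℝ] ℝ)
      (E := fun y : N ↦ TangentSpace I' y →L[ℝ] Bundle.Trivial N ℝ y) (f y) (η (f y))) x :=
    ((hη (f x)).mdifferentiableAt (by simp)).comp x hs.base
  have h : MDifferentiableAt I (I'.prod 𝓘(ℝ)) (fun y ↦ TotalSpace.mk' ℝ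
      (E := Bundle.Trivial N ℝ) (f y) (η (f y) (s y))) x :=
    MDifferentiableAt.clm_bundle_apply (b := f) (F₁ := E') (F₂ := ℝ) hη' hs
  exact ((mdifferentiableAt_totalSpace _ _).1 h).2

lemma MDiffAlongAt.inner [RiemannianBundle (fun y : N ↦ TangentSpace I' y)]
    [IsContMDiffRiemannianBundle I' ∞ E' (fun y : N ↦ TangentSpace I' y)]
    (hs : MDiffAlongAt I f s x) (ht : MDiffAlongAt I f t x) :
    MDifferentiableAt I 𝓘(ℝ) (fun y ↦ (inner ℝ (s y) (t y) : ℝ)) x := by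
  have : IsContMDiffRiemannianBundle I' 1 E' (fun y : N ↦ TangentSpace I' y) :=
    IsContMDiffRiemannianBundle.of_le (n := ∞) (by simp)
  exact MDifferentiableAt.inner_bundle hs ht

variable [FiniteDimensional ℝ E']

/-- If `∇J = 0` then `J` commutes with the covariant derivative along a map. -/
lemma covAlong_endo {J : ∀ y : N, TangentSpace I' y →L[ℝ] TangentSpace I' y}
    (hJ : IsSmoothEndo J)
    (hpar : ∀ (y : N) (Z : ∀ y : N, TangentSpace I' y),
      MDifferentiableAt I' I'.tangent (fun y ↦ (⟨y, Z y⟩ : TangentBundle I' N)) y →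
      ∀ v, covDerivEndo cov J Z y v = 0)
    (hs : MDiffAlongAt I f s x) (v : TangentSpace I x) :
    covAlong cov f (fun y ↦ J (f y) (s y)) x v = J (f x) (covAlong cov f s x v) := by
  induction hs using MDiffAlongAt.induction with
  | congr s t hs h ih =>
    rw [← covAlong_congr h, ← ih]
    refine DFunLike.congr_fun (covAlong_congr (h.mono fun y hy ↦ ?_)).symm v
    rw [hy]
  | add s t hs ht ihs iht =>
    simp only [map_add]
    rw [covAlong_add hs ht, covAlong_add (hJ.mdiffAlongAt hs) (hJ.mdiffAlongAt ht)]
    simp only [_root_.add_apply, map_add, ihs, iht]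
  | smul g s hg hs ih =>
    simp only [map_smul]
    rw [covAlong_smul hg hs, covAlong_smul hg (hJ.mdiffAlongAt hs)]
    simp [ih]
  | comp Z hZ hf =>
    rw [covAlong_comp hZ hf, covAlong_comp (Z := fun y ↦ J y (Z y)) _ hf]
    · exact sub_eq_zero.1 (hpar (f x) Z hZ (mfderiv I I' f x v))
    · exact hJ.mdiffAlongAt (f := fun y ↦ y) hZ

/-- Both sides are additive in s and t and obey the same Leibniz rule, which reduces the claim to
restrictions of fields of N, where it is metricity of `cov` and the chain rule. -/
lemma covAlong_inner [RiemannianBundle (fun y : N ↦ TangentSpace I' y)]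
    [IsContMDiffRiemannianBundle I' ∞ E' (fun y : N ↦ TangentSpace I' y)] (hcov : IsLeviCivita cov)
    (hs : MDiffAlongAt I f s x) (ht : MDiffAlongAt I f t x) (v : TangentSpace I x) :
    mvfderiv I (fun y ↦ (inner ℝ (s y) (t y) : ℝ)) x v =
      inner ℝ (covAlong cov f s x v) (t x) + inner ℝ (s x) (covAlong cov f t x v) := by
  induction hs using MDiffAlongAt.induction with
  | congr s s' hs h ih =>
    rw [← covAlong_congr h, ← h.self_of_nhds, ← ih]
    refine DFunLike.congr_fun (mvfderiv_congr_of_eventuallyEq (h.mono fun y hy ↦ ?_)).symm v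
    simp only [hy]
  | add s s' hs hs' ih ih' =>
    simp only [inner_add_left]
    rw [covAlong_add hs hs', mvfderiv_fun_add (hs.inner ht) (hs'.inner ht)]
    simp only [_root_.add_apply, inner_add_left, ih, ih']
    ring
  | smul g s hg hs ih =>
    simp only [real_inner_smul_left]
    rw [covAlong_smul hg hs, mvfderiv_fun_mul hg (hs.inner ht)]
    simp [inner_add_left, real_inner_smul_left, ih]
    ring
  -- With s now the restriction of a field of N, the same reduction is run on t.
  | comp Z hZ hf =>
    have hZf := MDiffAlongAt.comp hZ hf
    induction ht using MDiffAlongAt.induction with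
    | congr s s' hs h ih =>
      rw [← covAlong_congr h, ← h.self_of_nhds, ← ih]
      refine DFunLike.congr_fun (mvfderiv_congr_of_eventuallyEq (h.mono fun y hy ↦ ?_)).symm v
      simp only [hy]
    | add s s' hs hs' ih ih' =>
      simp only [inner_add_right]
      rw [covAlong_add hs hs', mvfderiv_fun_add (hZf.inner hs) (hZf.inner hs')]
      simp only [_root_.add_apply, inner_add_right, ih, ih']
      ring
    | smul g s hg hs ih =>
      simp only [real_inner_smul_right]
      rw [covAlong_smul hg hs, mvfderiv_fun_mul hg (hZf.inner hs)]
      simp [inner_add_right, real_inner_smul_right, ih]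
      ring
    | comp W hW hf =>
      rw [covAlong_comp hZ hf, covAlong_comp hW hf]
      have h := mvfderiv_comp_apply x
        (MDiffAlongAt.inner (f := fun y : N ↦ y) (s := Z) (t := W) hZ hW) hf v
      exact h.trans (hcov.metric (f x) Z W hZ hW (mfderiv I I' f x v))

end Structures

/-! ### The Lie bracket as a commutator of derivations. -/

section Torsion

variable {E : Type*} [NormedAddCommGroup E] [NormedSpace ℝ E]
  {H : Type*} [TopologicalSpace H] {I : ModelWithCorners ℝ E H}
  {M : Type*} [TopologicalSpace M] [ChartedSpace H M] [IsManifold I ∞ M]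
  {F : Type*} [NormedAddCommGroup F] [NormedSpace ℝ F]

/-- The representative of a vector field in the chart at `x`. -/
noncomputable def chartField (x : M) (X : ∀ y : M, TangentSpace I y) : E → E :=
  mpullbackWithin 𝓘(ℝ, E) I (extChartAt I x).symm X (Set.range I)

/-- The inverse chart pushes `chartField` forward to X, so this is the chain rule. It holds at every
z of the chart target where g is differentiable, as needed to differentiate once more. -/
lemma fderiv_comp_extChartAt_symm [I.Boundaryless] {g : M → F} {x : M} {z : E}
    (hz : z ∈ (extChartAt I x).target)
    (hg : MDifferentiableAt I 𝓘(ℝ, F) g ((extChartAt I x).symm z))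
    (X : ∀ y : M, TangentSpace I y) :
    fderiv ℝ (g ∘ (extChartAt I x).symm) z (chartField x X z) =
      mvfderiv I g ((extChartAt I x).symm z) (X ((extChartAt I x).symm z)) := by
  have hinv := isInvertible_mfderivWithin_extChartAt_symm (I := I) hz
  have hd := mdifferentiableWithinAt_extChartAt_symm (I := I) hz
  have hc := mfderiv_comp_mfderivWithin (I := 𝓘(ℝ, E)) z hg hd
    (I.uniqueMDiffOn z (extChartAt_target_subset_range x hz))
  rw [← mfderiv_eq_fderiv, ← mfderivWithin_univ, ← I.range_eq_univ, hc]
  obtain ⟨D, hD⟩ := hinv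
  have hXz : mfderivWithin 𝓘(ℝ, E) I (extChartAt I x).symm (Set.range I) z (chartField x X z : E) =
      X ((extChartAt I x).symm z) := by
    unfold chartField
    rw [mpullbackWithin_apply, ← hD, ContinuousLinearMap.inverse_equiv]
    exact D.apply_symm_apply _
  rw [← hXz]
  rfl

lemma differentiableAt_chartField [I.Boundaryless] [CompleteSpace E] {x : M}
    {X : ∀ y : M, TangentSpace I y}
    (hX : MDifferentiableAt I I.tangent (fun y ↦ (⟨y, X y⟩ : TangentBundle I M)) x) :
    DifferentiableAt ℝ (chartField x X) (extChartAt I x x) := by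
  have h : DifferentiableWithinAt ℝ (chartField x X)
      ((extChartAt I x).symm ⁻¹' Set.univ ∩ Set.range I) (extChartAt I x x) :=
    (hX.mdifferentiableWithinAt (s := Set.univ)).differentiableWithinAt_mpullbackWithin_vectorField
  rwa [Set.preimage_univ, Set.univ_inter, I.range_eq_univ, differentiableWithinAt_univ] at h

lemma chartField_self (x : M) (X : ∀ y : M, TangentSpace I y) :
    chartField x X (extChartAt I x x) = X x := by
  -- Every tangent space is a copy of E, so values of X at propositionally equal points can be
  -- compared in E.
  have hX : ∀ y, y = x → (X y : E) = X x := by rintro _ rfl; rfl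
  unfold chartField
  rw [mpullbackWithin_apply, mfderivWithin_range_extChartAt_symm]
  exact (DFunLike.congr_fun (ContinuousLinearMap.inverse_id (R := ℝ) (M := E)) _).trans
    (hX _ (extChartAt_to_inv x))

lemma mlieBracket_eq_chartField [I.Boundaryless] (x : M) (X Y : ∀ y : M, TangentSpace I y) :
    mlieBracket I X Y x =
      lieBracket ℝ (chartField x X) (chartField x Y) (extChartAt I x x) := by
  have h : lieBracketWithin ℝ (chartField x X) (chartField x Y)
      ((extChartAt I x).symm ⁻¹' Set.univ ∩ Set.range I) (extChartAt I x x) =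
      lieBracket ℝ (chartField x X) (chartField x Y) (extChartAt I x x) := by
    rw [Set.preimage_univ, Set.univ_inter, I.range_eq_univ, lieBracketWithin_univ]
  rw [← h, ← mlieBracketWithin_univ, mlieBracketWithin_apply, mfderiv_extChartAt_self]
  exact DFunLike.congr_fun (ContinuousLinearMap.inverse_id (R := ℝ) (M := E)) _

lemma mdifferentiableAt_of_comp_extChartAt_symm {h : M → F} {x : M}
    (hd : DifferentiableAt ℝ (h ∘ (extChartAt I x).symm) (extChartAt I x x)) :
    MDifferentiableAt I 𝓘(ℝ, F) h x := by
  have : IsManifold I 1 M := IsManifold.of_le (n := ∞) (by simp)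
  rw [← mdifferentiableWithinAt_univ]
  exact hd.differentiableWithinAt.mdifferentiableWithinAt_of_comp_extChartAt_symm

lemma mvfderiv_eq_fderiv [I.Boundaryless] {h : M → F} {x : M} {k : E → F}
    (hk : DifferentiableAt ℝ k (extChartAt I x x))
    (heq : h ∘ (extChartAt I x).symm =ᶠ[𝓝 (extChartAt I x x)] k) (v : TangentSpace I x) :
    mvfderiv I h x v = fderiv ℝ k (extChartAt I x x) v := by
  have hd := heq.differentiableAt_iff.2 hk
  rw [(mdifferentiableAt_of_comp_extChartAt_symm hd).mvfderiv, I.range_eq_univ,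
    fderivWithin_univ, ← heq.fderiv_eq]
  rfl

/-- In the chart, the second derivatives of g cancel by symmetry and the first-order terms form the
bracket. Vector values are allowed so that g can be a chart, or a chart composed with f. -/
lemma mvfderiv_mlieBracket [I.Boundaryless] [CompleteSpace E] {g : M → F} {x : M}
    (hg : ContMDiffAt I 𝓘(ℝ, F) ∞ g x)
    {X Y : ∀ y : M, TangentSpace I y}
    (hX : MDifferentiableAt I I.tangent (fun y ↦ (⟨y, X y⟩ : TangentBundle I M)) x)
    (hY : MDifferentiableAt I I.tangent (fun y ↦ (⟨y, Y y⟩ : TangentBundle I M)) x) :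
    mvfderiv I g x (mlieBracket I X Y x) =
      mvfderiv I (fun y ↦ mvfderiv I g y (Y y)) x (X x) -
      mvfderiv I (fun y ↦ mvfderiv I g y (X y)) x (Y x) := by
  have hG : ContDiffAt ℝ ∞ (g ∘ (extChartAt I x).symm) (extChartAt I x x) := by
    have h := (contMDiffAt_iff.1 hg).2
    rwa [I.range_eq_univ, contDiffWithinAt_univ] at h
  have hev : ∀ᶠ z in 𝓝 (extChartAt I x x), z ∈ (extChartAt I x).target ∧
      MDifferentiableAt I 𝓘(ℝ, F) g ((extChartAt I x).symm z) := by
    have : IsManifold I 1 M := IsManifold.of_le (n := ∞) (by simp)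
    have h1 : ∀ᶠ y in 𝓝 x, MDifferentiableAt I 𝓘(ℝ, F) g y :=
      ((contMDiffAt_iff_contMDiffAt_nhds (n := 1) (by simp)).1 (hg.of_le (by simp))).mono fun y hy ↦
        hy.mdifferentiableAt one_ne_zero
    have h2 : Tendsto (extChartAt I x).symm (𝓝 (extChartAt I x x)) (𝓝 x) := by
      simpa using (continuousAt_extChartAt_symm (I := I) x).tendsto
    exact Eventually.and (extChartAt_target_mem_nhds (I := I) x) (h2.eventually h1)
  have h2 : (2 : WithTop ℕ∞) ≤ ∞ := WithTop.coe_le_coe.2 (le_top : (2 : ℕ∞) ≤ ⊤)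
  have hdG : DifferentiableAt ℝ (fderiv ℝ (g ∘ (extChartAt I x).symm)) (extChartAt I x x) :=
    (hG.fderiv_right (m := 1) h2).differentiableAt one_ne_zero
  -- Product rule: D(DG · Y)(X) = D²G(X, Y) + DG(DY(X)).
  have key {X Y : ∀ y : M, TangentSpace I y}
      (hY : MDifferentiableAt I I.tangent (fun y ↦ (⟨y, Y y⟩ : TangentBundle I M)) x) :
      mvfderiv I (fun y ↦ mvfderiv I g y (Y y)) x (X x) =
        fderiv ℝ (fderiv ℝ (g ∘ (extChartAt I x).symm)) (extChartAt I x x)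
          (chartField x X (extChartAt I x x)) (chartField x Y (extChartAt I x x)) +
        fderiv ℝ (g ∘ (extChartAt I x).symm) (extChartAt I x x)
          (fderiv ℝ (chartField x Y) (extChartAt I x x) (chartField x X (extChartAt I x x))) := by
    have hdY := differentiableAt_chartField hY
    have heq : (fun y ↦ mvfderiv I g y (Y y)) ∘ (extChartAt I x).symm =ᶠ[𝓝 (extChartAt I x x)]
        fun z ↦ fderiv ℝ (g ∘ (extChartAt I x).symm) z (chartField x Y z) :=
      hev.mono fun z hz ↦ (fderiv_comp_extChartAt_symm hz.1 hz.2 Y).symm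
    have hk := DFunLike.congr_fun (fderiv_clm_apply hdG hdY) (chartField x X (extChartAt I x x))
    simp only [_root_.add_apply, ContinuousLinearMap.comp_apply, ContinuousLinearMap.flip_apply]
      at hk
    rw [add_comm, ← hk]
    exact (mvfderiv_eq_fderiv (hdG.clm_apply hdY) heq (X x)).trans
      (congrArg _ (chartField_self x X).symm)
  have hsymm := (hG.isSymmSndFDerivAt (by simpa using h2)).eq (chartField x X (extChartAt I x x))
    (chartField x Y (extChartAt I x x))
  have hgx := mvfderiv_eq_fderiv (hG.differentiableAt (by simp)) (EventuallyEq.refl _ _)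
    (mlieBracket I X Y x)
  rw [key hX, key hY, hgx, mlieBracket_eq_chartField, lieBracket, map_sub, hsymm]
  abel

end Torsion

/-! ### Vanishing torsion along a map. -/

section TorsionAlong

variable {E : Type*} [NormedAddCommGroup E] [NormedSpace ℝ E]
  {H : Type*} [TopologicalSpace H] {I : ModelWithCorners ℝ E H}
  {M : Type*} [TopologicalSpace M] [ChartedSpace H M] [IsManifold I ∞ M]
  {E' : Type*} [NormedAddCommGroup E'] [NormedSpace ℝ E']
  {H' : Type*} [TopologicalSpace H'] {I' : ModelWithCorners ℝ E' H'}
  {N : Type*} [TopologicalSpace N] [ChartedSpace H' N] [IsManifold I' ∞ N]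
  {f : M → N} {x : M}

lemma mdiffAlongAt_mfderiv (hf : ContMDiff I I' ∞ f) {Y : ∀ y : M, TangentSpace I y}
    (hY : MDifferentiableAt I I.tangent (fun y ↦ (⟨y, Y y⟩ : TangentBundle I M)) x) :
    MDiffAlongAt I f (fun y ↦ mfderiv I I' f y (Y y)) x := by
  have h : ContMDiff I.tangent I'.tangent 1 (tangentMap I I' f) :=
    hf.contMDiff_tangentMap (m := 1)
      (by exact WithTop.coe_le_coe.2 (le_top : (1 + 1 : ℕ∞) ≤ ⊤))
  exact (h.mdifferentiableAt one_ne_zero).comp x hY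

/-- The trivialization of the tangent bundle at z is the derivative of the chart at z. -/
lemma coord_mfderiv (hf : MDifferentiableAt I I' f x) {z : N}
    (hx : f x ∈ (chartAt H' z).source) (v : TangentSpace I x) :
    (trivializationAt E' (TangentSpace I' : N → Type _) z
      (⟨f x, mfderiv I I' f x v⟩ : TangentBundle I' N)).2 =
      mvfderiv I (extChartAt I' z ∘ f) x v := by
  have : IsManifold I' 1 N := IsManifold.of_le (n := ∞) (by simp)
  have h1 := mfderiv_comp_apply x (mdifferentiableAt_extChartAt (I := I') hx) hf v
  have h2 := DFunLike.congr_fun (TangentBundle.continuousLinearMapAt_trivializationAt (𝕜 := ℝ)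
    (I := I') hx) (mfderiv I I' f x v)
  rw [Trivialization.continuousLinearMapAt_apply_of_mem] at h2
  · exact h2.trans h1.symm
  · exact hx

variable [FiniteDimensional ℝ E] [I.Boundaryless]

/-- Extensions are constant-coefficient combinations of coordinate fields, which commute. The
bracket formula is applied to the chart itself, whose derivative at x is the identity. -/
lemma mlieBracket_extend {x : M} (a b : TangentSpace I x) :
    mlieBracket I (FiberBundle.extend E a) (FiberBundle.extend E b) x = 0 := by
  have : CompleteSpace E := FiniteDimensional.complete ℝ E
  have : IsManifold I 1 M := IsManifold.of_le (n := ∞) (by simp)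
  have hconst (a : TangentSpace I x) :
      (fun y ↦ mvfderiv I (extChartAt I x) y (FiberBundle.extend E a y)) =ᶠ[𝓝 x]
      fun _ ↦ (trivializationAt E (TangentSpace I : M → Type _) x
        (⟨x, a⟩ : TangentBundle I M)).2 := by
    filter_upwards [(chartAt H x).open_source.mem_nhds (mem_chart_source H x)] with y hy
    have h := DFunLike.congr_fun (TangentBundle.continuousLinearMapAt_trivializationAt (𝕜 := ℝ)
      (I := I) hy) (FiberBundle.extend E a y)
    rw [Trivialization.continuousLinearMapAt_apply_of_mem] at h
    · refine h.symm.trans ?_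
      unfold FiberBundle.extend
      rw [Trivialization.apply_mk_symm _ hy]
    · exact hy
  have h := mvfderiv_mlieBracket (contMDiffAt_extChartAt (I := I) (x := x))
    (FiberBundle.mdifferentiableAt_extend I E a) (FiberBundle.mdifferentiableAt_extend I E b)
  rw [mvfderiv_congr_of_eventuallyEq (hconst a), mvfderiv_congr_of_eventuallyEq (hconst b),
    mvfderiv_const, mvfderiv_const] at h
  have h' := DFunLike.congr_fun (mfderiv_extChartAt_self (I := I) (x := x))
    (mlieBracket I (FiberBundle.extend E a) (FiberBundle.extend E b) x)
  exact h'.symm.trans (h.trans (sub_self (0 : E)))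

variable [FiniteDimensional ℝ E'] [I'.Boundaryless]
  {cov : CovariantDerivative I' E' (fun y : N ↦ TangentSpace I' y)}

/-- A torsion-free connection is torsion-free along every map. -/
lemma covAlong_mfderiv_sub_covAlong_mfderiv (hf : ContMDiff I I' ∞ f)
    (hcov : haveI : CompleteSpace E' := FiniteDimensional.complete ℝ E'; cov.torsion = 0)
    {X Y : ∀ y : M, TangentSpace I y}
    (hX : MDifferentiableAt I I.tangent (fun y ↦ (⟨y, X y⟩ : TangentBundle I M)) x)
    (hY : MDifferentiableAt I I.tangent (fun y ↦ (⟨y, Y y⟩ : TangentBundle I M)) x) :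
    covAlong cov f (fun y ↦ mfderiv I I' f y (Y y)) x (X x) -
      covAlong cov f (fun y ↦ mfderiv I I' f y (X y)) x (Y x) =
      mfderiv I I' f x (mlieBracket I X Y x) := by
  have : CompleteSpace E := FiniteDimensional.complete ℝ E
  have : CompleteSpace E' := FiniteDimensional.complete ℝ E'
  have hfd : MDifferentiable I I' f := hf.mdifferentiable (by simp)
  have hev : ∀ᶠ y in 𝓝 x, f y ∈ (chartAt H' (f x)).source :=
    hf.continuous.continuousAt.eventually
      ((chartAt H' (f x)).open_source.mem_nhds (mem_chart_source H' (f x)))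
  have hc (Y : ∀ y : M, TangentSpace I y) :
      (fun y ↦ (trivializationAt E' (TangentSpace I' : N → Type _) (f x)
        (⟨f y, mfderiv I I' f y (Y y)⟩ : TangentBundle I' N)).2) =ᶠ[𝓝 x]
      fun y ↦ mvfderiv I (extChartAt I' (f x) ∘ f) y (Y y) := by
    filter_upwards [hev] with y hy
    exact coord_mfderiv (hfd y) hy (Y y)
  have hF : ContMDiffAt I 𝓘(ℝ, E') ∞ (extChartAt I' (f x) ∘ f) x :=
    (contMDiffAt_extChartAt (I := I')).comp x (hf x)
  -- This handles the terms that differentiate components: their antisymmetrization is the bracket,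
  -- pushed forward by df.
  have hbr := mvfderiv_mlieBracket hF hX hY
  rw [← coord_mfderiv (hfd x) (mem_chart_source H' (f x))] at hbr
  -- On extensions the bracket vanishes, so zero torsion says that the Christoffel terms are
  -- symmetric.
  have htor := cov.torsion_apply_eq_extend (mfderiv I I' f x (X x)) (mfderiv I I' f x (Y x))
  rw [hcov, mlieBracket_extend] at htor
  simp only [FiberBundle.extend_apply_self] at htor
  rw [sub_zero] at htor
  have htor' := sub_eq_zero.1 htor.symm
  unfold covAlong
  rw [mvfderiv_congr_of_eventuallyEq (hc X), mvfderiv_congr_of_eventuallyEq (hc Y)]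
  have hL := congrArg ((trivializationAt E' (TangentSpace I' : N → Type _) (f x)).symmL ℝ (f x)) hbr
  rw [symmL_coord, map_sub] at hL
  rw [hL]
  simp only [_root_.add_apply, ContinuousLinearMap.comp_apply]
  rw [htor']
  abel

end TorsionAlong

/-- The map (v, c) ↦ L v + c ν is injective by orthogonality, hence surjective by equality of
dimensions. -/
lemma exists_eq_add_smul_of_isometry_of_normal {V W : Type*} [NormedAddCommGroup V]
    [InnerProductSpace ℝ V] [NormedAddCommGroup W] [InnerProductSpace ℝ W] [FiniteDimensional ℝ V]
    [FiniteDimensional ℝ W] (hd : Module.finrank ℝ W = Module.finrank ℝ V + 1) (L : V →ₗ[ℝ] W)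
    (hL : ∀ v w, inner ℝ (L v) (L w) = inner ℝ v w) {ν : W} (hν : inner ℝ ν ν = (1 : ℝ))
    (hνL : ∀ v, inner ℝ ν (L v) = (0 : ℝ)) (u : W) : ∃ (v : V) (c : ℝ), u = L v + c • ν := by
  let T : V × ℝ →ₗ[ℝ] W := L.coprod (LinearMap.toSpanSingleton ℝ W ν)
  have hinj : Function.Injective T := by
    rw [← LinearMap.ker_eq_bot, LinearMap.ker_eq_bot']
    rintro ⟨v, c⟩ h
    have h : L v + c • ν = 0 := by simpa [T] using h
    have h1 : inner ℝ ν (L v + c • ν) = (0 : ℝ) := by rw [h, inner_zero_right]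
    have h2 : inner ℝ (L v) (L v + c • ν) = (0 : ℝ) := by rw [h, inner_zero_right]
    have hc : c = 0 := by
      rwa [inner_add_right, real_inner_smul_right, hνL, hν, zero_add, mul_one] at h1
    have hv : v = 0 := by
      rwa [hc, zero_smul, add_zero, hL, inner_self_eq_zero] at h2
    rw [hc, hv, Prod.mk_zero_zero]
  have hsurj := (LinearMap.injective_iff_surjective_of_finrank_eq_finrank (f := T)
    (by simp [hd])).1 hinj
  obtain ⟨⟨v, c⟩, h⟩ := hsurj u
  exact ⟨v, c, by simpa [T] using h.symm⟩

/-! ### Gauss and Weingarten formulas; symmetry of the shape operator. -/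

section Hypersurface

variable {E : Type*} [NormedAddCommGroup E] [NormedSpace ℝ E]
  {H : Type*} [TopologicalSpace H] {I : ModelWithCorners ℝ E H}
  {M : Type*} [TopologicalSpace M] [ChartedSpace H M] [IsManifold I ∞ M]
  {E' : Type*} [NormedAddCommGroup E'] [NormedSpace ℝ E']
  {H' : Type*} [TopologicalSpace H'] {I' : ModelWithCorners ℝ E' H'}
  {N : Type*} [TopologicalSpace N] [ChartedSpace H' N] [IsManifold I' ∞ N]
  [FiniteDimensional ℝ E] [FiniteDimensional ℝ E']
  [RiemannianBundle (fun x : M ↦ TangentSpace I x)]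
  [IsContMDiffRiemannianBundle I ∞ E (fun x : M ↦ TangentSpace I x)]
  [RiemannianBundle (fun y : N ↦ TangentSpace I' y)]
  [IsContMDiffRiemannianBundle I' ∞ E' (fun y : N ↦ TangentSpace I' y)]
  {f : M → N} {ν : ∀ x : M, TangentSpace I' (f x)} {x : M}
  {covM : CovariantDerivative I E (fun x : M ↦ TangentSpace I x)}
  {covN : CovariantDerivative I' E' (fun y : N ↦ TangentSpace I' y)}

lemma exists_eq_mfderiv_add_smul (hd : Module.finrank ℝ E' = Module.finrank ℝ E + 1)
    (hf : IsIsometricImmersion I I' f) (hν : IsUnitNormal I f ν) (u : TangentSpace I' (f x)) :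
    ∃ (v : TangentSpace I x) (c : ℝ), u = mfderiv I I' f x v + c • ν x := by
  have : FiniteDimensional ℝ (TangentSpace I x) := inferInstanceAs (FiniteDimensional ℝ E)
  have : FiniteDimensional ℝ (TangentSpace I' (f x)) := inferInstanceAs (FiniteDimensional ℝ E')
  exact exists_eq_add_smul_of_isometry_of_normal (V := TangentSpace I x)
    (W := TangentSpace I' (f x)) hd (mfderiv I I' f x : TangentSpace I x →ₗ[ℝ] TangentSpace I' (f x))
    (hf.isometric x) (hν.unit x) (hν.normal x) u

lemma eq_of_inner_eq (hd : Module.finrank ℝ E' = Module.finrank ℝ E + 1)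
    (hf : IsIsometricImmersion I I' f) (hν : IsUnitNormal I f ν) {u u' : TangentSpace I' (f x)}
    (ht : ∀ w : TangentSpace I x,
      (inner ℝ u (mfderiv I I' f x w) : ℝ) = inner ℝ u' (mfderiv I I' f x w))
    (hn : (inner ℝ u (ν x) : ℝ) = inner ℝ u' (ν x)) : u = u' := by
  obtain ⟨v, c, h⟩ := exists_eq_mfderiv_add_smul hd hf hν (u - u')
  have h0 : inner ℝ (u - u') (u - u') = (0 : ℝ) := by
    conv_lhs => rw [h, inner_add_right, real_inner_smul_right, ← h]
    rw [inner_sub_left, inner_sub_left, ht, hn]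
    ring
  exact sub_eq_zero.1 (inner_self_eq_zero.1 h0)

lemma mfderiv_add_smul_inj (hf : IsIsometricImmersion I I' f) (hν : IsUnitNormal I f ν)
    {v w : TangentSpace I x} {a b : ℝ}
    (h : mfderiv I I' f x v + a • ν x = mfderiv I I' f x w + b • ν x) : v = w ∧ a = b := by
  have h1 := congrArg (fun u ↦ (inner ℝ (ν x) u : ℝ)) h
  have h2 := congrArg (fun u ↦ (inner ℝ u (mfderiv I I' f x (v - w)) : ℝ)) h
  simp only [inner_add_right, real_inner_smul_right, hν.normal, hν.unit, zero_add, mul_one] at h1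
  simp only [inner_add_left, real_inner_smul_left, hν.normal, hf.isometric, mul_zero,
    add_zero] at h2
  refine ⟨sub_eq_zero.1 (inner_self_eq_zero (𝕜 := ℝ).1 ?_), h1⟩
  rw [inner_sub_left, h2, sub_self]

lemma inner_shapeOperator (v w : TangentSpace I x) :
    inner ℝ (shapeOperator covN f ν x v) w =
      - inner ℝ (covAlong covN f ν x v) (mfderiv I I' f x w) := by
  unfold shapeOperator
  simp only [_root_.neg_apply, inner_neg_left, ContinuousLinearMap.comp_apply,
    ContinuousLinearMap.adjoint_inner_left]

lemma IsUnitNormal.mdiffAlongAt (hν : IsUnitNormal I f ν) : MDiffAlongAt I f ν x :=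
  (hν.smooth x).mdifferentiableAt (by simp)

/-- Differentiate ⟨ν, ν⟩ = 1. -/
lemma inner_covAlong_normal_self (hcovN : IsLeviCivita covN) (hν : IsUnitNormal I f ν)
    (v : TangentSpace I x) : inner ℝ (covAlong covN f ν x v) (ν x) = (0 : ℝ) := by
  have h := covAlong_inner hcovN (hν.mdiffAlongAt (x := x)) hν.mdiffAlongAt v
  simp only [hν.unit] at h
  rw [mvfderiv_const, real_inner_comm (covAlong covN f ν x v)] at h
  simp only [_root_.zero_apply] at h
  linarith

/-- Differentiate ⟨ν, df Y⟩ = 0. -/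
lemma inner_covAlong_mfderiv_normal (hcovN : IsLeviCivita covN) (hf : IsIsometricImmersion I I' f)
    (hν : IsUnitNormal I f ν) {Y : ∀ y : M, TangentSpace I y}
    (hY : MDifferentiableAt I I.tangent (fun y ↦ (⟨y, Y y⟩ : TangentBundle I M)) x)
    (v : TangentSpace I x) :
    inner ℝ (covAlong covN f (fun y ↦ mfderiv I I' f y (Y y)) x v) (ν x) =
      inner ℝ (shapeOperator covN f ν x v) (Y x) := by
  have h := covAlong_inner hcovN (hν.mdiffAlongAt (x := x)) (mdiffAlongAt_mfderiv hf.smooth hY) v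
  simp only [hν.normal] at h
  rw [mvfderiv_const] at h
  simp only [_root_.zero_apply] at h
  rw [inner_shapeOperator, real_inner_comm]
  linarith

variable [I.Boundaryless] [I'.Boundaryless]

/-- The tangential part of `∇̃_v (df Y)` is `df (∇_v Y)`, because it defines a metric torsion-free
connection. -/
lemma inner_covAlong_mfderiv_mfderiv (hcovN : IsLeviCivita covN) (hcovM : IsLeviCivita covM)
    (hf : IsIsometricImmersion I I' f) {Y : ∀ y : M, TangentSpace I y}
    (hY : MDifferentiableAt I I.tangent (fun y ↦ (⟨y, Y y⟩ : TangentBundle I M)) x)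
    (v w : TangentSpace I x) :
    inner ℝ (covAlong covN f (fun y ↦ mfderiv I I' f y (Y y)) x v) (mfderiv I I' f x w) =
      inner ℝ (covM Y x v) w := by
  have : CompleteSpace E := FiniteDimensional.complete ℝ E
  -- Let D(X, Y, Z) be the difference of the two sides. Metricity of both connections makes D skew
  -- in Y, Z; `hsym` below makes it symmetric in X, Y by vanishing torsion.
  have hskew {X Y Z : ∀ y : M, TangentSpace I y}
      (hY : MDifferentiableAt I I.tangent (fun y ↦ (⟨y, Y y⟩ : TangentBundle I M)) x)
      (hZ : MDifferentiableAt I I.tangent (fun y ↦ (⟨y, Z y⟩ : TangentBundle I M)) x) :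
      inner ℝ (covAlong covN f (fun y ↦ mfderiv I I' f y (Y y)) x (X x)) (mfderiv I I' f x (Z x)) -
        inner ℝ (covM Y x (X x)) (Z x) +
      (inner ℝ (covAlong covN f (fun y ↦ mfderiv I I' f y (Z y)) x (X x)) (mfderiv I I' f x (Y x)) -
        inner ℝ (covM Z x (X x)) (Y x)) = 0 := by
    have h1 := covAlong_inner hcovN (mdiffAlongAt_mfderiv hf.smooth hY)
      (mdiffAlongAt_mfderiv hf.smooth hZ) (X x)
    have h2 := hcovM.metric x Y Z hY hZ (X x)
    simp only [hf.isometric] at h1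
    rw [h2, real_inner_comm (covM Z x (X x)),
      real_inner_comm (covAlong covN f (fun y ↦ mfderiv I I' f y (Z y)) x (X x))] at h1
    linarith
  have hsym {X Y Z : ∀ y : M, TangentSpace I y}
      (hX : MDifferentiableAt I I.tangent (fun y ↦ (⟨y, X y⟩ : TangentBundle I M)) x)
      (hY : MDifferentiableAt I I.tangent (fun y ↦ (⟨y, Y y⟩ : TangentBundle I M)) x) :
      inner ℝ (covAlong covN f (fun y ↦ mfderiv I I' f y (Y y)) x (X x)) (mfderiv I I' f x (Z x)) -
        inner ℝ (covM Y x (X x)) (Z x) =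
      inner ℝ (covAlong covN f (fun y ↦ mfderiv I I' f y (X y)) x (Y x)) (mfderiv I I' f x (Z x)) -
        inner ℝ (covM X x (Y x)) (Z x) := by
    have h1 := covAlong_mfderiv_sub_covAlong_mfderiv hf.smooth hcovN.torsion_free hX hY
    have h2 := covM.torsion_eq_zero_iff.1 hcovM.torsion_free hX hY
    rw [← h2] at h1
    have h3 := congrArg (fun u ↦ inner ℝ u (mfderiv I I' f x (Z x))) h1
    simp only [hf.isometric, inner_sub_left] at h3
    linarith
  have hv := FiberBundle.mdifferentiableAt_extend I E v
  have hw := FiberBundle.mdifferentiableAt_extend I E w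
  set X := FiberBundle.extend E v
  set Z := FiberBundle.extend E w
  have hXv : X x = v := FiberBundle.extend_apply_self E v
  have hZw : Z x = w := FiberBundle.extend_apply_self E w
  rw [← hXv, ← hZw]
  -- Skew in the last two slots and symmetric in the first two forces D = 0: alternating the two
  -- symmetries returns D(X, Y, Z) to its own negative.
  linarith [hskew (X := X) hY hw, hskew (X := Y) hv hw, hskew (X := Z) hY hv,
    hsym (Z := Z) hv hY, hsym (Z := X) hY hw, hsym (Z := Y) hw hv]

lemma gauss_formula (hd : Module.finrank ℝ E' = Module.finrank ℝ E + 1)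
    (hcovN : IsLeviCivita covN) (hcovM : IsLeviCivita covM)
    (hf : IsIsometricImmersion I I' f) (hν : IsUnitNormal I f ν) {Y : ∀ y : M, TangentSpace I y}
    (hY : MDifferentiableAt I I.tangent (fun y ↦ (⟨y, Y y⟩ : TangentBundle I M)) x)
    (v : TangentSpace I x) :
    covAlong covN f (fun y ↦ mfderiv I I' f y (Y y)) x v =
      mfderiv I I' f x (covM Y x v) +
        (inner ℝ (shapeOperator covN f ν x v) (Y x) : ℝ) • ν x := by
  refine eq_of_inner_eq hd hf hν (fun w ↦ ?_) ?_
  · rw [inner_covAlong_mfderiv_mfderiv hcovN hcovM hf hY, inner_add_left, real_inner_smul_left,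
      hν.normal, hf.isometric, mul_zero, add_zero]
  · rw [inner_covAlong_mfderiv_normal hcovN hf hν hY, inner_add_left, real_inner_smul_left,
      hν.unit, real_inner_comm (ν x) (mfderiv I I' f x _), hν.normal, mul_one, zero_add]

lemma weingarten_formula (hd : Module.finrank ℝ E' = Module.finrank ℝ E + 1)
    (hcovN : IsLeviCivita covN) (hf : IsIsometricImmersion I I' f) (hν : IsUnitNormal I f ν)
    (v : TangentSpace I x) :
    covAlong covN f ν x v = - mfderiv I I' f x (shapeOperator covN f ν x v) := by
  refine eq_of_inner_eq hd hf hν (fun w ↦ ?_) ?_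
  · rw [inner_neg_left, hf.isometric, inner_shapeOperator, neg_neg]
  · rw [inner_covAlong_normal_self hcovN hν, inner_neg_left, real_inner_comm (ν x), hν.normal,
      neg_zero]

/-- The normal component of the torsion identity along f: df of a bracket is tangential, so it
contributes nothing. -/
lemma inner_shapeOperator_comm (hcovN : IsLeviCivita covN)
    (hf : IsIsometricImmersion I I' f) (hν : IsUnitNormal I f ν) (v w : TangentSpace I x) :
    inner ℝ (shapeOperator covN f ν x v) w = inner ℝ v (shapeOperator covN f ν x w) := by
  have : CompleteSpace E := FiniteDimensional.complete ℝ E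
  have hv := FiberBundle.mdifferentiableAt_extend I E v
  have hw := FiberBundle.mdifferentiableAt_extend I E w
  have h := congrArg (fun u ↦ (inner ℝ u (ν x) : ℝ))
    (covAlong_mfderiv_sub_covAlong_mfderiv hf.smooth hcovN.torsion_free hv hw)
  simp only [inner_sub_left, inner_covAlong_mfderiv_normal hcovN hf hν hv,
    inner_covAlong_mfderiv_normal hcovN hf hν hw, FiberBundle.extend_apply_self] at h
  rw [real_inner_comm (ν x) (mfderiv I I' f x _), hν.normal, sub_eq_zero] at h
  rw [h, real_inner_comm]

end Hypersurface

/-! ### The structure equations of a quadratic metric φ-hypersurface. -/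

section Main

variable {E : Type*} [NormedAddCommGroup E] [NormedSpace ℝ E]
  {H : Type*} [TopologicalSpace H] {I : ModelWithCorners ℝ E H}
  {M : Type*} [TopologicalSpace M] [ChartedSpace H M] [IsManifold I ∞ M]
  {E' : Type*} [NormedAddCommGroup E'] [NormedSpace ℝ E']
  {H' : Type*} [TopologicalSpace H'] {I' : ModelWithCorners ℝ E' H'}
  {N : Type*} [TopologicalSpace N] [ChartedSpace H' N] [IsManifold I' ∞ N]
  [FiniteDimensional ℝ E] [FiniteDimensional ℝ E']
  [RiemannianBundle (fun x : M ↦ TangentSpace I x)]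
  [IsContMDiffRiemannianBundle I ∞ E (fun x : M ↦ TangentSpace I x)]
  [RiemannianBundle (fun y : N ↦ TangentSpace I' y)]
  [IsContMDiffRiemannianBundle I' ∞ E' (fun y : N ↦ TangentSpace I' y)]
  {f : M → N} {ν : ∀ x : M, TangentSpace I' (f x)} {x : M}
  {covM : CovariantDerivative I E (fun x : M ↦ TangentSpace I x)}
  {covN : CovariantDerivative I' E' (fun y : N ↦ TangentSpace I' y)}
  {p q : ℕ} {J : ∀ y : N, TangentSpace I' y →L[ℝ] TangentSpace I' y}
  {φ : ∀ x : M, TangentSpace I x →L[ℝ] TangentSpace I x}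
  {η : ∀ x : M, TangentSpace I x →L[ℝ] ℝ} {ξ : ∀ x : M, TangentSpace I x}

namespace IsQuadraticMetricHypersurface

/-- Evaluate ⟨J df v, ν⟩ = ⟨df v, Jν⟩ using the decompositions of J. -/
lemma η_eq_smul_inner (hJ : IsMetallicRiemannian p q J)
    (hM : IsQuadraticMetricHypersurface p q J f ν φ η ξ) (v : TangentSpace I x) :
    η x v = q * inner ℝ (ξ x) v := by
  have h := hJ.symm (f x) (mfderiv I I' f x v) (ν x)
  rw [hM.J_tangent, hM.J_normal] at h
  simp only [inner_add_right, real_inner_smul_right, hM.normal.unit, hM.immersion.isometric,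
    real_inner_comm (ν x), hM.normal.normal] at h
  rw [real_inner_comm]
  linarith

/-- The normalization `Jξ = ν` forces `q = 1`. -/
lemma q_eq_one (hJ : IsMetallicRiemannian p q J)
    (hM : IsQuadraticMetricHypersurface p q J f ν φ η ξ) (x : M) : (q : ℝ) = 1 := by
  have h := hM.J_tangent x (ξ x)
  rw [hM.J_ξ, hM.almostQuadratic.φ_ξ, hM.η_eq_smul_inner hJ, hM.almostQuadratic.unit] at h
  have h' := congrArg (fun u ↦ (inner ℝ (ν x) u : ℝ)) h
  simp only [map_zero, zero_add, mul_one, real_inner_smul_right, hM.normal.unit] at h'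
  exact h'.symm

lemma η_eq_inner (hJ : IsMetallicRiemannian p q J)
    (hM : IsQuadraticMetricHypersurface p q J f ν φ η ξ) (v : TangentSpace I x) :
    η x v = inner ℝ (ξ x) v := by
  rw [hM.η_eq_smul_inner hJ, hM.q_eq_one hJ x, one_mul]

variable [I.Boundaryless] [I'.Boundaryless]

/-- Tangential and normal parts of ∇̃(Jν) = J(∇̃ν). The normal part equates g(Av, ξ) with its own
negative. -/
lemma cov_ξ (hN : IsLocallyMetallicRiemannian p q covN J) (hcovM : IsLeviCivita covM)
    (hM : IsQuadraticMetricHypersurface p q J f ν φ η ξ) (v : TangentSpace I x) :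
    covM ξ x v = (p : ℝ) • shapeOperator covN f ν x v - φ x (shapeOperator covN f ν x v) ∧
      inner ℝ (ξ x) (shapeOperator covN f ν x v) = (0 : ℝ) := by
  have hq := hM.q_eq_one hN.metallic x
  have hξ := (hM.almostQuadratic.smooth_ξ x).mdifferentiableAt (by simp)
  have hν := hM.normal.mdiffAlongAt (x := x)
  have h := covAlong_endo hN.metallic.smooth hN.parallel hν v
  simp only [hM.J_normal] at h
  have hξ' := mdiffAlongAt_mfderiv hM.immersion.smooth hξ
  -- The constants q and p are treated as functions; their derivative terms in the Leibniz rule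
  -- vanish.
  rw [covAlong_add (MDiffAlongAt.smul mdifferentiableAt_const hξ')
    (MDiffAlongAt.smul mdifferentiableAt_const hν), covAlong_smul mdifferentiableAt_const hξ',
    covAlong_smul mdifferentiableAt_const hν] at h
  simp only [mvfderiv_const, _root_.add_apply, _root_.smul_apply,
    ContinuousLinearMap.smulRight_apply, _root_.zero_apply, zero_smul, add_zero] at h
  rw [gauss_formula hM.codim_one hN.leviCivita hcovM hM.immersion hM.normal hξ,
    weingarten_formula hM.codim_one hN.leviCivita hM.immersion hM.normal, map_neg, hM.J_tangent,
    hM.η_eq_inner hN.metallic, hq, one_smul] at h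
  set A := shapeOperator covN f ν x v
  have h' : mfderiv I I' f x (covM ξ x v) + (inner ℝ A (ξ x) : ℝ) • ν x =
      mfderiv I I' f x ((p : ℝ) • A - φ x A) + (-(inner ℝ (ξ x) A : ℝ)) • ν x := by
    rw [map_sub, map_smul]
    rw [← sub_eq_zero] at h ⊢
    rw [← h]
    module
  obtain ⟨h1, h2⟩ := mfderiv_add_smul_inj hM.immersion hM.normal h'
  refine ⟨h1, ?_⟩
  rw [real_inner_comm] at h2
  linarith

/-- Tangential and normal parts of ∇̃(J df Y) = J(∇̃ df Y). Here q = 1 removes the factor q from the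
ξ term coming from Jν. -/
lemma cov_φ_η (hN : IsLocallyMetallicRiemannian p q covN J) (hcovM : IsLeviCivita covM)
    (hM : IsQuadraticMetricHypersurface p q J f ν φ η ξ) {Y : ∀ y : M, TangentSpace I y}
    (hY : MDifferentiableAt I I.tangent (fun y ↦ (⟨y, Y y⟩ : TangentBundle I M)) x)
    (v : TangentSpace I x) :
    covDerivEndo covM φ Y x v = η x (Y x) • shapeOperator covN f ν x v +
        (inner ℝ (shapeOperator covN f ν x v) (Y x) : ℝ) • ξ x ∧
      covDerivForm covM η Y x v = (p : ℝ) * inner ℝ (shapeOperator covN f ν x v) (Y x) -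
        inner ℝ (shapeOperator covN f ν x v) (φ x (Y x)) := by
  have hq := hM.q_eq_one hN.metallic x
  have hν := hM.normal.mdiffAlongAt (x := x)
  have hφY : MDifferentiableAt I I.tangent (fun y ↦ (⟨y, φ y (Y y)⟩ : TangentBundle I M)) x :=
    hM.almostQuadratic.smooth_φ.mdiffAlongAt (f := fun y ↦ y) hY
  have hηY : MDifferentiableAt I 𝓘(ℝ) (fun y ↦ η y (Y y)) x :=
    hM.almostQuadratic.smooth_η.mdifferentiableAt (f := fun y ↦ y) hY
  have h := covAlong_endo hN.metallic.smooth hN.parallel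
    (mdiffAlongAt_mfderiv hM.immersion.smooth hY) v
  simp only [hM.J_tangent] at h
  rw [covAlong_add (mdiffAlongAt_mfderiv hM.immersion.smooth hφY) (MDiffAlongAt.smul hηY hν),
    covAlong_smul hηY hν] at h
  simp only [_root_.add_apply, _root_.smul_apply, ContinuousLinearMap.smulRight_apply] at h
  rw [gauss_formula hM.codim_one hN.leviCivita hcovM hM.immersion hM.normal hφY,
    gauss_formula hM.codim_one hN.leviCivita hcovM hM.immersion hM.normal hY,
    weingarten_formula hM.codim_one hN.leviCivita hM.immersion hM.normal, map_add, map_smul,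
    hM.J_tangent, hM.J_normal, hq, one_smul] at h
  unfold covDerivEndo covDerivForm
  set A := shapeOperator covN f ν x v
  have h' : mfderiv I I' f x (covM (fun y ↦ φ y (Y y)) x v - φ x (covM Y x v)) +
        (mvfderiv I (fun y ↦ η y (Y y)) x v - η x (covM Y x v)) • ν x =
      mfderiv I I' f x (η x (Y x) • A + (inner ℝ A (Y x) : ℝ) • ξ x) +
        ((p : ℝ) * inner ℝ A (Y x) - inner ℝ A (φ x (Y x))) • ν x := by
    rw [map_sub, map_add, map_smul, map_smul]
    rw [← sub_eq_zero] at h ⊢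
    rw [← h]
    module
  exact mfderiv_add_smul_inj hM.immersion hM.normal h'

/-- By symmetry of A, |Aξ|² = g(ξ, A(Aξ)), which is zero because the image of A is orthogonal to ξ.
-/
lemma shapeOperator_ξ (hN : IsLocallyMetallicRiemannian p q covN J) (hcovM : IsLeviCivita covM)
    (hM : IsQuadraticMetricHypersurface p q J f ν φ η ξ) (x : M) :
    shapeOperator covN f ν x (ξ x) = 0 := by
  refine inner_self_eq_zero (𝕜 := ℝ).1 ?_
  rw [inner_shapeOperator_comm hN.leviCivita hM.immersion hM.normal]
  exact (hM.cov_ξ hN hcovM _).2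

end IsQuadraticMetricHypersurface
end Main

end MetallicHypersurface

theorem mainTheorem6 {n : ℕ}
    -- the ambient manifold `N` of dimension `n + 1` with its Riemannian metric
    {N : Type*} [TopologicalSpace N] [ChartedSpace (EuclideanSpace ℝ (Fin (n + 1))) N]
    [IsManifold (𝓡 (n + 1)) ∞ N]
    [RiemannianBundle (fun y : N ↦ TangentSpace (𝓡 (n + 1)) y)]
    [IsContMDiffRiemannianBundle (𝓡 (n + 1)) ∞ (EuclideanSpace ℝ (Fin (n + 1)))
      (fun y : N ↦ TangentSpace (𝓡 (n + 1)) y)]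
    -- the manifold `M` of dimension `n` with its Riemannian metric
    {M : Type*} [TopologicalSpace M] [ChartedSpace (EuclideanSpace ℝ (Fin n)) M]
    [IsManifold (𝓡 n) ∞ M]
    [RiemannianBundle (fun x : M ↦ TangentSpace (𝓡 n) x)]
    [IsContMDiffRiemannianBundle (𝓡 n) ∞ (EuclideanSpace ℝ (Fin n))
      (fun x : M ↦ TangentSpace (𝓡 n) x)]
    (p q : ℕ)
    (covN : CovariantDerivative (𝓡 (n + 1)) (EuclideanSpace ℝ (Fin (n + 1)))
      (fun y : N ↦ TangentSpace (𝓡 (n + 1)) y))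
    (J : ∀ y : N, TangentSpace (𝓡 (n + 1)) y →L[ℝ] TangentSpace (𝓡 (n + 1)) y)
    (hN : MetallicHypersurface.IsLocallyMetallicRiemannian p q covN J)
    (covM : CovariantDerivative (𝓡 n) (EuclideanSpace ℝ (Fin n))
      (fun x : M ↦ TangentSpace (𝓡 n) x))
    (hcovM : MetallicHypersurface.IsLeviCivita covM)
    (f : M → N) (ν : ∀ x : M, TangentSpace (𝓡 (n + 1)) (f x))
    (φ : ∀ x : M, TangentSpace (𝓡 n) x →L[ℝ] TangentSpace (𝓡 n) x)
    (η : ∀ x : M, TangentSpace (𝓡 n) x →L[ℝ] ℝ)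
    (ξ : ∀ x : M, TangentSpace (𝓡 n) x)
    (hM : MetallicHypersurface.IsQuadraticMetricHypersurface p q J f ν φ η ξ)
    (A : ∀ x : M, TangentSpace (𝓡 n) x →L[ℝ] TangentSpace (𝓡 n) x)
    (hA : A = MetallicHypersurface.shapeOperator covN f ν) :
    -- `(∇_X φ)Y = η(Y) AX + g(AX, Y) ξ`
    (∀ (x : M) (X : TangentSpace (𝓡 n) x) (Y : ∀ y : M, TangentSpace (𝓡 n) y),
      MDifferentiableAt (𝓡 n) (𝓡 n).tangent (fun y ↦ (⟨y, Y y⟩ : TangentBundle (𝓡 n) M)) x →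
      MetallicHypersurface.covDerivEndo covM φ Y x X
        = η x (Y x) • A x X + (inner ℝ (A x X) (Y x) : ℝ) • ξ x) ∧
    -- `∇_X ξ = p AX - φ AX`
    (∀ (x : M) (X : TangentSpace (𝓡 n) x), covM ξ x X = (p : ℝ) • A x X - φ x (A x X)) ∧
    -- `Aξ = 0`
    (∀ x : M, A x (ξ x) = 0) ∧
    -- `(∇_X η)Y = p g(AX, Y) - g(AX, φY)`
    (∀ (x : M) (X : TangentSpace (𝓡 n) x) (Y : ∀ y : M, TangentSpace (𝓡 n) y),
      MDifferentiableAt (𝓡 n) (𝓡 n).tangent (fun y ↦ (⟨y, Y y⟩ : TangentBundle (𝓡 n) M)) x →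
      MetallicHypersurface.covDerivForm covM η Y x X
        = (p : ℝ) * inner ℝ (A x X) (Y x) - inner ℝ (A x X) (φ x (Y x))) := by
  subst hA
  exact ⟨fun x X Y hY ↦ (hM.cov_φ_η hN hcovM hY X).1, fun x X ↦ (hM.cov_ξ hN hcovM X).1,
    fun x ↦ hM.shapeOperator_ξ hN hcovM x, fun x X Y hY ↦ (hM.cov_φ_η hN hcovM hY X).2⟩
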